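/- Let the pseudo-factorials $(\alpha_n)_{n\ge 0}$ be the integers defined by $\alpha_0=1$ and \[ \alpha_{n+1}=(-1)^{n+1}\sum_{k=0}^{n}\binom{n}{k}\alpha_k\,\alpha_{n-k}\qquad(n\ge 0). \] Let $\pi_3:=3\int_0^1\frac{dy}{(1-y^3)^{2/3}}$, let $r$ be the real number with $6r=2^{-1/3}\pi_3$, let $\rho:=2\sqrt3\,r$, and let $\zeta:=e^{i\pi/6}$. Then for every integer $n\ge 2$ the following double series converges absolutely, and \[ \alpha_n=-\frac{n!}{\rho^{\,n+1}}\sum_{\lambda,\mu\in\mathbb{Z}}\frac{\zeta^{8\lambda+4\mu}}{\left[\left(\lambda-\frac12\right)\zeta+\left(\mu-\frac12\right)\zeta^{-1}\right]^{n+1}}. \] -/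

import Mathlib

/-- The pseudo-factorials: `α 0 = 1` and
`α (n+1) = (-1)^(n+1) * ∑_{k=0}^{n} (n choose k) * α k * α (n-k)`. -/
def pseudoFactorial : ℕ → ℤ
  | 0 => 1
  | n + 1 => (-1) ^ (n + 1) *
      ∑ k : Fin (n + 1),
        (n.choose k : ℤ) * pseudoFactorial k * pseudoFactorial (n - k)
decreasing_by
  · exact k.isLt
  · exact Nat.lt_succ_of_le (Nat.sub_le n k)

theorem pseudoFactorial_zero : pseudoFactorial 0 = 1 := by
  rw [pseudoFactorial]

theorem pseudoFactorial_succ (n : ℕ) :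
    pseudoFactorial (n + 1) = (-1) ^ (n + 1) *
      ∑ k ∈ Finset.range (n + 1),
        (n.choose k : ℤ) * pseudoFactorial k * pseudoFactorial (n - k) := by
  rw [pseudoFactorial, Finset.sum_range]

/-- The period `π₃ = 3 ∫₀¹ dy / (1 - y³)^(2/3)`. -/
noncomputable def piThree : ℝ :=
  3 * ∫ y in (0 : ℝ)..1, 1 / (1 - y ^ 3) ^ (2 / 3 : ℝ)

/-- The number `r` defined by `6 r = π₃ 2^(-1/3)`. -/
noncomputable def hexR : ℝ := piThree * (2 : ℝ) ^ (-(1 / 3) : ℝ) / 6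

/-- `ρ = 2 √3 r`. -/
noncomputable def hexRho : ℝ := 2 * Real.sqrt 3 * hexR

/-- The primitive twelfth root of unity `ζ = e^{iπ/6}`. -/
noncomputable def hexZeta : ℂ := Complex.exp (Complex.I * (Real.pi : ℂ) / 6)

/-- The term of index `(l, m)` of the hexagonal lattice sum of exponent `n + 1`. -/
noncomputable def hexTerm (n : ℕ) (l m : ℤ) : ℂ :=
  hexZeta ^ (8 * l + 4 * m) /
    (((l : ℂ) - 1 / 2) * hexZeta + ((m : ℂ) - 1 / 2) * hexZeta⁻¹) ^ (n + 1)

open Complex Filter Topology ComplexConjugate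

/-! ### The root of unity, the poles and the character -/

/-! The lattice sums are the Taylor coefficients at `0` of a meromorphic function F (`hexFun`) with
a simple pole of residue `hexChar i` at each `hexPole i`. A regularised sum plus an affine term
makes F exactly quasi-periodic: translation by ζ, ζ⁻¹ multiplies it by ω², ω, where ω = ζ⁴.

The heart is `deriv_hexFun`: F'(z) = -F(-z)². The function F'(z) + F(-z)² has only removable
singularities, and its quasi-periodicity has nontrivial multipliers, so Liouville makes it vanish.
Differentiating repeatedly at `0` reproduces the pseudo-factorial recurrence, F⁽ⁿ⁾(0) = F(0)ⁿ⁺¹ αₙ;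
comparison with the lattice expansion leaves only F(0) = ρ to prove.

On the real axis F(x)³ + F(-x)³ is constant, and threefold symmetry forces F(√3/6) = 0. The
substitution y = F(-x) / (2^(1/3) F(0)) on [-√3/6, √3/6] then turns the integral defining π₃ into
that of a constant (`piThree_eq`). -/

theorem hexZeta_re : hexZeta.re = √3 / 2 := by
  have : Complex.I * (Real.pi : ℂ) / 6 = ((Real.pi / 6 : ℝ) : ℂ) * I := by push_cast; ring
  rw [hexZeta, this, Complex.exp_ofReal_mul_I_re, Real.cos_pi_div_six]

theorem hexZeta_im : hexZeta.im = 1 / 2 := by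
  have : Complex.I * (Real.pi : ℂ) / 6 = ((Real.pi / 6 : ℝ) : ℂ) * I := by push_cast; ring
  rw [hexZeta, this, Complex.exp_ofReal_mul_I_im, Real.sin_pi_div_six]

theorem hexZeta_ne_zero : hexZeta ≠ 0 := Complex.exp_ne_zero _

theorem norm_hexZeta : ‖hexZeta‖ = 1 := by
  have : Complex.I * (Real.pi : ℂ) / 6 = ((Real.pi / 6 : ℝ) : ℂ) * I := by push_cast; ring
  rw [hexZeta, this, Complex.norm_exp_ofReal_mul_I]

theorem hexZeta_inv_eq_conj : hexZeta⁻¹ = conj hexZeta := by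
  rw [Complex.inv_def, Complex.normSq_eq_norm_sq, norm_hexZeta]; simp

theorem hexZeta_inv_re : (hexZeta⁻¹).re = √3 / 2 := by
  rw [hexZeta_inv_eq_conj, conj_re, hexZeta_re]

theorem hexZeta_inv_im : (hexZeta⁻¹).im = -(1 / 2) := by
  rw [hexZeta_inv_eq_conj, conj_im, hexZeta_im]

theorem hexZeta_add_inv : hexZeta + hexZeta⁻¹ = (√3 : ℝ) := by
  apply Complex.ext <;> simp only [add_re, add_im, hexZeta_re, hexZeta_im, hexZeta_inv_re,
    hexZeta_inv_im, ofReal_re, ofReal_im] <;> ring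

theorem hexZeta_pow_four : hexZeta ^ 4 = hexZeta ^ 2 - 1 := by
  have h3 : ((√3 : ℝ) : ℂ) ^ 2 = 3 := by
    rw [← ofReal_pow, Real.sq_sqrt (by norm_num)]; norm_num
  rw [← hexZeta_add_inv] at h3
  have := hexZeta_ne_zero
  field_simp at h3
  linear_combination h3

theorem hexZeta_inv : hexZeta⁻¹ = hexZeta - hexZeta ^ 3 := by
  apply inv_eq_of_mul_eq_one_right
  linear_combination -hexZeta_pow_four

theorem hexZeta_pow_six : hexZeta ^ 6 = -1 := by
  linear_combination (hexZeta ^ 2 + 1) * hexZeta_pow_four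

theorem hexZeta_pow_twelve : hexZeta ^ 12 = 1 := by
  linear_combination (hexZeta ^ 6 - 1) * hexZeta_pow_six

/-- The primitive cube root of unity `ζ ^ 4`. -/
noncomputable def hexOmega : ℂ := hexZeta ^ 4

theorem hexOmega_pow_three : hexOmega ^ 3 = 1 := by
  rw [hexOmega, ← pow_mul, hexZeta_pow_twelve]

theorem hexOmega_ne_zero : hexOmega ≠ 0 := pow_ne_zero _ hexZeta_ne_zero

theorem hexOmega_im : hexOmega.im = √3 / 2 := by
  rw [hexOmega, hexZeta_pow_four]
  simp [pow_two, hexZeta_re, hexZeta_im]; ring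

theorem hexOmega_ne_one : hexOmega ≠ 1 := by
  intro h
  have := hexOmega_im
  rw [h, one_im] at this
  have h3 : (0 : ℝ) < √3 / 2 := by positivity
  linarith

theorem norm_hexOmega : ‖hexOmega‖ = 1 := by simp [hexOmega, norm_hexZeta]

theorem hexOmega_sq_ne_one : hexOmega ^ 2 ≠ 1 := by
  intro h
  apply hexOmega_ne_one
  linear_combination hexOmega_pow_three - hexOmega * h

theorem conj_hexOmega : conj hexOmega = hexOmega ^ 2 := by
  rw [hexOmega, map_pow, ← hexZeta_inv_eq_conj, inv_pow]
  apply inv_eq_of_mul_eq_one_right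
  linear_combination hexZeta_pow_twelve

theorem hexOmega_mul_zeta : hexOmega * hexZeta = -hexZeta⁻¹ := by
  rw [hexZeta_inv, hexOmega]; linear_combination hexZeta * hexZeta_pow_four

theorem hexOmega_mul_zeta_inv : hexOmega * hexZeta⁻¹ = hexZeta - hexZeta⁻¹ := by
  have := hexZeta_ne_zero
  rw [hexOmega]; field_simp; linear_combination hexZeta_pow_four

/-- The points of the shifted hexagonal lattice. -/
noncomputable def hexPole (i : ℤ × ℤ) : ℂ :=
  ((i.1 : ℂ) - 1 / 2) * hexZeta + ((i.2 : ℂ) - 1 / 2) * hexZeta⁻¹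

/-- The numerators of the lattice sum. -/
noncomputable def hexChar (i : ℤ × ℤ) : ℂ := hexZeta ^ (8 * i.1 + 4 * i.2)

theorem hexTerm_eq (n : ℕ) (i : ℤ × ℤ) :
    hexTerm n i.1 i.2 = hexChar i / hexPole i ^ (n + 1) := rfl

theorem norm_hexChar (i : ℤ × ℤ) : ‖hexChar i‖ = 1 := by
  simp [hexChar, norm_hexZeta]

theorem hexChar_eq (i : ℤ × ℤ) : hexChar i = hexOmega ^ (2 * i.1 + i.2) := by
  rw [hexChar, hexOmega, ← zpow_natCast, ← zpow_mul]; congr 1; push_cast; ring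

theorem hexOmega_zpow_mod {a b k : ℤ} (h : a = b + 3 * k) : hexOmega ^ a = hexOmega ^ b := by
  rw [h, zpow_add₀ hexOmega_ne_zero, zpow_mul]
  have : hexOmega ^ (3 : ℤ) = 1 := by exact_mod_cast hexOmega_pow_three
  rw [this]; simp

theorem hexPole_re (i : ℤ × ℤ) : (hexPole i).re = ((i.1 : ℝ) + i.2 - 1) * (√3 / 2) := by
  simp only [hexPole, add_re, mul_re, sub_re, sub_im, intCast_re, intCast_im, hexZeta_re,
    hexZeta_inv_re, hexZeta_im, hexZeta_inv_im]
  norm_num; ring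

theorem hexPole_im (i : ℤ × ℤ) : (hexPole i).im = ((i.1 : ℝ) - i.2) / 2 := by
  simp only [hexPole, add_im, mul_im, sub_re, sub_im, intCast_re, intCast_im, hexZeta_re,
    hexZeta_inv_re, hexZeta_im, hexZeta_inv_im]
  norm_num; ring

theorem hexPole_injective : Function.Injective hexPole := by
  intro i j h
  have h1 := congrArg re h
  have h2 := congrArg im h
  rw [hexPole_re, hexPole_re] at h1
  rw [hexPole_im, hexPole_im] at h2
  have h3 : (√3 / 2 : ℝ) ≠ 0 := by positivity
  have h4 := mul_right_cancel₀ h3 h1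
  have h5 : (i.1 : ℝ) = j.1 := by linarith
  have h6 : (i.2 : ℝ) = j.2 := by linarith
  exact Prod.ext (by exact_mod_cast h5) (by exact_mod_cast h6)

theorem half_le_norm_hexPole (i : ℤ × ℤ) : 1 / 2 ≤ ‖hexPole i‖ := by
  by_cases h : i.1 = i.2
  · refine le_trans ?_ (abs_re_le_norm _)
    rw [hexPole_re, h, abs_mul, abs_of_pos (show (0 : ℝ) < √3 / 2 by positivity)]
    have h1 : (1 : ℝ) ≤ |(i.2 : ℝ) + i.2 - 1| := by
      have : (1 : ℤ) ≤ |i.2 + i.2 - 1| := Int.one_le_abs (by omega)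
      exact_mod_cast this
    have h2 : (1 : ℝ) ≤ √3 := Real.one_le_sqrt.2 (by norm_num)
    nlinarith
  · refine le_trans ?_ (abs_im_le_norm _)
    rw [hexPole_im, abs_div]
    have h1 : (1 : ℝ) ≤ |(i.1 : ℝ) - i.2| := by
      have : (1 : ℤ) ≤ |i.1 - i.2| := Int.one_le_abs (by omega)
      exact_mod_cast this
    norm_num; linarith

theorem hexPole_ne_zero (i : ℤ × ℤ) : hexPole i ≠ 0 := by
  have := half_le_norm_hexPole i
  intro h; rw [h] at this; norm_num at this

theorem hexPole_notMem_of_norm_lt {z : ℂ} (hz : ‖z‖ < 1 / 2) : z ∉ Set.range hexPole := by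
  rintro ⟨i, rfl⟩
  exact absurd hz (not_lt.2 (half_le_norm_hexPole i))

/-! ### Absolute convergence -/

theorem summable_norm_hexPole_cube : Summable fun i => 1 / ‖hexPole i‖ ^ 3 := by
  have him : 0 < (hexZeta ^ 2).im := by
    rw [pow_two, mul_im, hexZeta_re, hexZeta_im]; ring_nf; positivity
  -- Multiplied by 2ζ, the poles become the odd-odd points of the lattice ℤζ² + ℤ, so a weight-3
  -- Eisenstein series dominates.
  have h := EisensteinSeries.summable_norm_eisSummand (k := 3) le_rfl ⟨hexZeta ^ 2, him⟩
  have hinj : Function.Injective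
      (fun i : ℤ × ℤ => (![2 * i.1 - 1, 2 * i.2 - 1] : Fin 2 → ℤ)) := by
    intro i j hij
    have h0 := congrFun hij 0
    have h1 := congrFun hij 1
    simp at h0 h1
    exact Prod.ext (by omega) (by omega)
  refine ((h.comp_injective hinj).mul_left 8).congr fun i => ?_
  have : hexPole i = ((2 * i.1 - 1 : ℤ) * hexZeta ^ 2 + (2 * i.2 - 1 : ℤ)) / (2 * hexZeta) := by
    have := hexZeta_ne_zero
    rw [hexPole]; field_simp; push_cast; ring
  rw [this]
  simp [EisensteinSeries.eisSummand, norm_hexZeta, div_pow]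
  norm_num
  rfl

theorem summable_hexPole_of_bound {f : ℤ × ℤ → ℂ} (C : ℝ)
    (h : ∀ᶠ i in cofinite, ‖f i‖ ≤ C * (1 / ‖hexPole i‖ ^ 3)) : Summable f :=
  Summable.of_norm_bounded_eventually (summable_norm_hexPole_cube.mul_left C) h

theorem finite_norm_hexPole_le (R : ℝ) : {i | ‖hexPole i‖ ≤ R}.Finite := by
  have h := summable_norm_hexPole_cube.tendsto_cofinite_zero
  have hR : 0 < 1 / (|R| + 1) ^ 3 := by positivity
  have h2 := h.eventually (gt_mem_nhds hR)
  refine Set.Finite.subset h2 ?_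
  intro i hi
  have hi' : ‖hexPole i‖ ≤ R := hi
  have h0 := norm_pos_iff.2 (hexPole_ne_zero i)
  simp only [Set.mem_ofPred_eq, Set.mem_compl_iff, not_lt]
  apply one_div_le_one_div_of_le (by positivity)
  gcongr
  linarith [le_abs_self R]

theorem summable_hexTerm {n : ℕ} (hn : 2 ≤ n) :
    Summable fun p : ℤ × ℤ => hexTerm n p.1 p.2 := by
  apply summable_hexPole_of_bound 1
  filter_upwards [(finite_norm_hexPole_le 1).compl_mem_cofinite] with i hi
  have hi' : 1 < ‖hexPole i‖ := by simpa using hi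
  rw [hexTerm_eq, norm_div, norm_hexChar, norm_pow, one_mul]
  apply one_div_le_one_div_of_le (by positivity)
  exact pow_le_pow_right₀ hi'.le (by omega)

/-! ### The regularised lattice sum and its symmetries -/

/-- The regularised simple fraction with pole `hexPole i` and residue `hexChar i`. -/
noncomputable def hexFraction (i : ℤ × ℤ) (z : ℂ) : ℂ :=
  hexChar i * (1 / (z - hexPole i) + 1 / hexPole i + z / hexPole i ^ 2)

theorem hexFraction_eq {i : ℤ × ℤ} {z : ℂ} (h : z ≠ hexPole i) :
    hexFraction i z = hexChar i * (z ^ 2 / (hexPole i ^ 2 * (z - hexPole i))) := by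
  have h1 := sub_ne_zero.2 h
  have h2 := hexPole_ne_zero i
  rw [hexFraction]; congr 1; field_simp; ring

theorem norm_hexFraction_le {i : ℤ × ℤ} {z : ℂ} {R : ℝ} (hz : ‖z‖ ≤ R)
    (hi : 2 * R < ‖hexPole i‖) :
    ‖hexFraction i z‖ ≤ 2 * R ^ 2 * (1 / ‖hexPole i‖ ^ 3) := by
  have h0 : 0 < ‖hexPole i‖ := norm_pos_iff.2 (hexPole_ne_zero i)
  have h1 : ‖hexPole i‖ / 2 ≤ ‖z - hexPole i‖ := by
    rw [norm_sub_rev]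
    linarith [norm_sub_norm_le (hexPole i) z]
  have hne : z ≠ hexPole i := by
    rintro rfl
    rw [sub_self, norm_zero] at h1
    linarith
  rw [hexFraction_eq hne, norm_mul, norm_hexChar, one_mul, norm_div, norm_mul, norm_pow, norm_pow]
  calc ‖z‖ ^ 2 / (‖hexPole i‖ ^ 2 * ‖z - hexPole i‖)
      ≤ R ^ 2 / (‖hexPole i‖ ^ 2 * (‖hexPole i‖ / 2)) := by gcongr
    _ = 2 * R ^ 2 * (1 / ‖hexPole i‖ ^ 3) := by field_simp

theorem summable_hexFraction (z : ℂ) : Summable fun i => hexFraction i z := by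
  apply summable_hexPole_of_bound (2 * ‖z‖ ^ 2)
  filter_upwards [(finite_norm_hexPole_le (2 * ‖z‖)).compl_mem_cofinite] with i hi
  exact norm_hexFraction_le le_rfl (by simpa using hi)

/-- The regularised lattice sum with residue `hexChar i` at `hexPole i`. -/
noncomputable def hexSum (z : ℂ) : ℂ := ∑' i, hexFraction i z

/-- Only finitely many poles have norm at most 2R; the remaining fractions are bounded on the ball
of radius R by a multiple of 1/‖p‖³, so their sum is analytic there. -/
theorem hexSum_decomposition (z₀ : ℂ) : ∃ (s : Finset (ℤ × ℤ)) (T : ℂ → ℂ),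
    AnalyticAt ℂ T z₀ ∧ (∀ i, hexPole i = z₀ → i ∈ s) ∧
    ∀ z, hexSum z = ∑ i ∈ s, hexFraction i z + T z := by
  set R := ‖z₀‖ + 1 with hR
  set s := (finite_norm_hexPole_le (2 * R)).toFinset with hs
  have hmem : ∀ i, i ∉ s → 2 * R < ‖hexPole i‖ := by
    intro i hi
    simpa [hs] using hi
  refine ⟨s, fun z => ∑' i : {i // i ∉ s}, hexFraction i z, ?_, ?_, ?_⟩
  · have hd : DifferentiableOn ℂ (fun z => ∑' i : {i // i ∉ s}, hexFraction i z)
        (Metric.ball 0 R) := by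
      apply differentiableOn_tsum_of_summable_norm
        (u := fun i : {i // i ∉ s} => 2 * R ^ 2 * (1 / ‖hexPole i‖ ^ 3))
      · exact (summable_norm_hexPole_cube.mul_left _).subtype _
      · rintro ⟨i, hi⟩ z hz
        have hz' : ‖z‖ < R := by simpa using hz
        have hne : z - hexPole i ≠ 0 := by
          intro h
          have := hmem i hi
          rw [← sub_eq_zero.1 h] at this
          linarith [norm_nonneg z]
        have : DifferentiableAt ℂ (fun z => hexFraction i z) z := by
          unfold hexFraction
          fun_prop (disch := assumption)
        exact this.differentiableWithinAt
      · exact Metric.isOpen_ball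
      · rintro ⟨i, hi⟩ z hz
        exact norm_hexFraction_le (by simpa using (Metric.mem_ball.1 hz).le) (hmem i hi)
    exact hd.analyticAt (Metric.isOpen_ball.mem_nhds (by simp [hR]))
  · rintro i rfl
    simp only [hs, Set.Finite.mem_toFinset, Set.mem_ofPred_eq]
    linarith [norm_nonneg (hexPole i)]
  · intro z
    exact ((summable_hexFraction z).sum_add_tsum_subtype_compl s).symm

theorem analyticAt_hexFraction {i : ℤ × ℤ} {z : ℂ} (h : z ≠ hexPole i) :
    AnalyticAt ℂ (hexFraction i) z := by
  have := sub_ne_zero.2 h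
  have h2 := hexPole_ne_zero i
  have h3 := pow_ne_zero 2 h2
  unfold hexFraction
  fun_prop (disch := assumption)

theorem analyticAt_hexSum {z : ℂ} (hz : z ∉ Set.range hexPole) : AnalyticAt ℂ hexSum z := by
  obtain ⟨s, T, hT, -, h⟩ := hexSum_decomposition z
  rw [funext h]
  refine AnalyticAt.add (Finset.analyticAt_fun_sum _ fun i _ => analyticAt_hexFraction ?_) hT
  rintro rfl
  exact hz ⟨i, rfl⟩

theorem hexSum_near_pole (i : ℤ × ℤ) : ∃ r : ℂ → ℂ, AnalyticAt ℂ r (hexPole i) ∧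
    ∀ z, hexSum z = hexChar i / (z - hexPole i) + r z := by
  obtain ⟨s, T, hT, hs, h⟩ := hexSum_decomposition (hexPole i)
  refine ⟨fun z => hexChar i * (1 / hexPole i + z / hexPole i ^ 2) +
    (∑ j ∈ s.erase i, hexFraction j z + T z), ?_, fun z => ?_⟩
  · have h2 := hexPole_ne_zero i
    have h3 := pow_ne_zero 2 h2
    refine AnalyticAt.add (by fun_prop (disch := assumption)) (AnalyticAt.add
      (Finset.analyticAt_fun_sum _ fun j hj => analyticAt_hexFraction ?_) hT)
    exact fun h => (Finset.ne_of_mem_erase hj) (hexPole_injective h).symm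
  · rw [h, ← Finset.add_sum_erase s _ (hs i rfl), hexFraction]; ring

/-- An affine map permuting the poles matches the singular parts term by term; what is left of each
term is affine in z, hence so is the sum. -/
theorem hexSum_affine {σ : Equiv.Perm (ℤ × ℤ)} {α β v : ℂ} (hα : α ≠ 0)
    (hp : ∀ i, hexPole (σ i) = α * hexPole i + β) (hc : ∀ i, hexChar (σ i) = v * hexChar i) :
    ∃ c d, ∀ z, α * hexSum (α * z + β) = v * hexSum z + c * z + d := by
  set f : ℂ → ℤ × ℤ → ℂ := fun z i =>
    α * hexFraction (σ i) (α * z + β) - v * hexFraction i z with hf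
  have hs1 (z : ℂ) : Summable fun i => α * hexFraction (σ i) (α * z + β) :=
    ((σ.summable_iff (f := fun i => hexFraction i (α * z + β))).2
      (summable_hexFraction _)).mul_left α
  have hs2 (z : ℂ) : Summable fun i => v * hexFraction i z := (summable_hexFraction _).mul_left v
  have hsf (z : ℂ) : Summable (f z) := (hs1 z).sub (hs2 z)
  have hsum (z : ℂ) : ∑' i, f z i = α * hexSum (α * z + β) - v * hexSum z := by
    rw [hf, (hs1 z).tsum_sub (hs2 z), tsum_mul_left, tsum_mul_left, hexSum, hexSum,
      σ.tsum_eq (fun i => hexFraction i (α * z + β))]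
  have hval (z : ℂ) (i : ℤ × ℤ) : f z i = v * hexChar i * (α * (1 / hexPole (σ i) +
      (α * z + β) / hexPole (σ i) ^ 2) - 1 / hexPole i - z / hexPole i ^ 2) := by
    -- Also true at the pole, where both sides are 0; hence the functional equations hold for every
    -- z.
    have h : α * (1 / (α * z + β - hexPole (σ i))) = 1 / (z - hexPole i) := by
      rw [hp, show α * z + β - (α * hexPole i + β) = α * (z - hexPole i) by ring, one_div,
        mul_inv, ← mul_assoc, mul_inv_cancel₀ hα, one_mul, one_div]
    simp only [hf, hexFraction, hc]
    linear_combination v * hexChar i * h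
  have haff (z : ℂ) (i : ℤ × ℤ) : f z i = f 0 i + z * (f 1 i - f 0 i) := by
    rw [hval, hval, hval]; ring
  refine ⟨∑' i, (f 1 i - f 0 i), ∑' i, f 0 i, fun z => ?_⟩
  have := hsum z
  rw [funext (haff z), (hsf 0).tsum_add (((hsf 1).sub (hsf 0)).mul_left z), tsum_mul_left] at this
  linear_combination -this

theorem hexPole_add (i j : ℤ × ℤ) :
    hexPole (i + j) = hexPole i + (j.1 * hexZeta + j.2 * hexZeta⁻¹) := by
  simp only [hexPole, Prod.fst_add, Prod.snd_add]; push_cast; ring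

theorem hexChar_add (i j : ℤ × ℤ) :
    hexChar (i + j) = hexOmega ^ (2 * j.1 + j.2) * hexChar i := by
  rw [hexChar_eq, hexChar_eq, ← zpow_add₀ hexOmega_ne_zero]; congr 1
  simp only [Prod.fst_add, Prod.snd_add]; ring

/-- Since ω² ≠ 1, the affine defect of the translation by ζ can be absorbed by solving for A, then
B. -/
theorem exists_hexSum_correction : ∃ A B : ℂ, ∀ z,
    hexSum (z + hexZeta) + (A * (z + hexZeta) + B) =
      hexOmega ^ 2 * (hexSum z + (A * z + B)) := by
  obtain ⟨c, d, h⟩ := hexSum_affine (σ := Equiv.addRight (1, 0)) (α := 1) (β := hexZeta)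
    (v := hexOmega ^ 2) one_ne_zero
    (fun i => by rw [Equiv.coe_addRight, hexPole_add]; simp)
    (fun i => by rw [Equiv.coe_addRight, hexChar_add]; norm_cast)
  have h1 := sub_ne_zero.2 hexOmega_sq_ne_one
  refine ⟨c / (hexOmega ^ 2 - 1),
    (d + c / (hexOmega ^ 2 - 1) * hexZeta) / (hexOmega ^ 2 - 1), fun z => ?_⟩
  have := h z
  rw [one_mul, one_mul] at this
  rw [this]
  field_simp
  ring

/-- The slope of the affine correction of `hexSum`. -/
noncomputable def hexSlope : ℂ := exists_hexSum_correction.choose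

/-- The constant term of the affine correction of `hexSum`. -/
noncomputable def hexConst : ℂ := exists_hexSum_correction.choose_spec.choose

/-- The quasi-periodic meromorphic function with residue `hexChar i` at `hexPole i`. -/
noncomputable def hexFun (z : ℂ) : ℂ := hexSum z + (hexSlope * z + hexConst)

theorem hexFun_add_zeta (z : ℂ) : hexFun (z + hexZeta) = hexOmega ^ 2 * hexFun z :=
  exists_hexSum_correction.choose_spec.choose_spec z

theorem affine_eq_zero_of_quasiperiodic {a b l u : ℂ} (hu : u ≠ 1)
    (h : ∀ z, a * (z + l) + b = u * (a * z + b)) : a = 0 ∧ b = 0 := by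
  have h1 := sub_ne_zero.2 hu
  have h2 : (u - 1) * a = 0 := by linear_combination h 0 - h 1
  have ha := (mul_eq_zero.1 h2).resolve_left h1
  have h3 : (u - 1) * b = 0 := by
    have := h 0
    rw [ha] at this
    linear_combination -this
  exact ⟨ha, (mul_eq_zero.1 h3).resolve_left h1⟩

/-- The defect is affine and inherits the multiplier ω² under translation by ζ, so it is zero: the
correction chosen for a single translation makes the other symmetries exact too. -/
theorem hexFun_symm {σ : Equiv.Perm (ℤ × ℤ)} {α β v : ℂ} (hα : α ≠ 0)
    (hp : ∀ i, hexPole (σ i) = α * hexPole i + β) (hc : ∀ i, hexChar (σ i) = v * hexChar i)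
    (hq : ∀ z, hexFun (α * (z + hexZeta) + β) = hexOmega ^ 2 * hexFun (α * z + β)) (z : ℂ) :
    α * hexFun (α * z + β) = v * hexFun z := by
  obtain ⟨c, d, h⟩ := hexSum_affine hα hp hc
  have h' : ∀ z, α * hexFun (α * z + β) - v * hexFun z =
      (c + α * hexSlope * α - v * hexSlope) * z +
        (d + α * (hexSlope * β + hexConst) - v * hexConst) := by
    intro z
    rw [hexFun, hexFun]
    linear_combination h z
  obtain ⟨h1, h2⟩ := affine_eq_zero_of_quasiperiodic (l := hexZeta) hexOmega_sq_ne_one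
    (fun z => by rw [← h', ← h', hq, hexFun_add_zeta]; ring)
  have := h' z
  rw [h1, h2] at this
  linear_combination this

theorem hexFun_add_zeta_inv (z : ℂ) : hexFun (z + hexZeta⁻¹) = hexOmega * hexFun z := by
  have := hexFun_symm (σ := Equiv.addRight (0, 1)) (α := 1) (β := hexZeta⁻¹)
    (v := hexOmega) one_ne_zero
    (fun i => by rw [Equiv.coe_addRight, hexPole_add]; simp)
    (fun i => by rw [Equiv.coe_addRight, hexChar_add]; simp)
    (fun z => by
      rw [one_mul, one_mul, ← hexFun_add_zeta]; congr 1; ring) z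
  simpa using this

theorem hexFun_sub_zeta_inv (z : ℂ) : hexFun (z - hexZeta⁻¹) = hexOmega ^ 2 * hexFun z := by
  have := hexFun_add_zeta_inv (z - hexZeta⁻¹)
  rw [sub_add_cancel] at this
  rw [this]
  linear_combination -hexFun (z - hexZeta⁻¹) * hexOmega_pow_three

/-- The rotation of the index set about `j`. -/
def hexRotation (j : ℤ × ℤ) : Equiv.Perm (ℤ × ℤ) where
  toFun i := (j.1 - j.2 + i.2, 2 * j.2 + j.1 - i.1 - i.2)
  invFun i := (j.2 + 2 * j.1 - i.2 - i.1, i.1 - j.1 + j.2)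
  left_inv i := by ext <;> simp <;> ring
  right_inv i := by ext <;> simp; ring

theorem hexFun_rotation (j : ℤ × ℤ) (z : ℂ) :
    hexOmega * hexFun (hexOmega * z + (hexPole j - hexOmega * hexPole j)) = hexFun z := by
  have := hexFun_symm (σ := hexRotation j) (α := hexOmega)
    (β := hexPole j - hexOmega * hexPole j) (v := 1) hexOmega_ne_zero
    (fun i => by
      simp only [hexRotation, Equiv.coe_fn_mk, hexPole]; push_cast
      linear_combination (j.1 - i.1 : ℂ) * hexOmega_mul_zeta +
        (j.2 - i.2 : ℂ) * hexOmega_mul_zeta_inv)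
    (fun i => by
      rw [one_mul, hexChar_eq, hexChar_eq]
      refine hexOmega_zpow_mod (k := j.1 - i.1) ?_
      simp only [hexRotation, Equiv.coe_fn_mk]; ring)
    (fun z => by
      rw [← hexFun_sub_zeta_inv]; congr 1
      linear_combination hexOmega_mul_zeta) z
  rwa [one_mul] at this

theorem conj_hexPole (i : ℤ × ℤ) : conj (hexPole i) = hexPole i.swap := by
  simp only [hexPole, map_add, map_mul, map_sub, ← hexZeta_inv_eq_conj, Prod.fst_swap,
    Prod.snd_swap, map_inv₀, inv_inv, map_div₀, map_one, map_intCast, conj_ofNat]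
  ring

theorem conj_hexChar (i : ℤ × ℤ) : conj (hexChar i) = hexChar i.swap := by
  rw [hexChar_eq, hexChar_eq, map_zpow₀, conj_hexOmega, ← zpow_natCast, ← zpow_mul]
  refine hexOmega_zpow_mod (k := i.1) ?_
  simp only [Prod.fst_swap, Prod.snd_swap]; push_cast; ring

theorem conj_hexSum (z : ℂ) : conj (hexSum (conj z)) = hexSum z := by
  rw [hexSum, hexSum, Complex.conj_tsum, ← (Equiv.prodComm ℤ ℤ).tsum_eq]
  congr 1; ext i
  simp only [hexFraction, map_mul, map_add, map_div₀, map_sub, map_pow, map_one, conj_conj,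
    conj_hexChar, conj_hexPole, Equiv.prodComm_apply, Prod.swap_swap]

/-- Conjugation swaps ζ with ζ⁻¹ and ω with ω², so the affine defect again has multiplier ω² and
vanishes. -/
theorem conj_hexFun (z : ℂ) : conj (hexFun (conj z)) = hexFun z := by
  have h : ∀ z, conj (hexFun (conj z)) - hexFun z =
      (conj hexSlope - hexSlope) * z + (conj hexConst - hexConst) := by
    intro z
    rw [hexFun, hexFun]
    simp only [map_add, map_mul, conj_hexSum, conj_conj]
    ring
  obtain ⟨h1, h2⟩ := affine_eq_zero_of_quasiperiodic (l := hexZeta) hexOmega_sq_ne_one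
    (fun z => by
      rw [← h, ← h, map_add, ← hexZeta_inv_eq_conj, hexFun_add_zeta_inv, hexFun_add_zeta,
        map_mul, conj_hexOmega]; ring)
  have := h z
  rw [h1, h2] at this
  linear_combination this

theorem hexFun_ofReal_im (x : ℝ) : (hexFun x).im = 0 := by
  have := conj_hexFun x
  rwa [conj_ofReal, conj_eq_iff_im] at this

theorem analyticAt_hexFun {z : ℂ} (hz : z ∉ Set.range hexPole) : AnalyticAt ℂ hexFun z :=
  (analyticAt_hexSum hz).add (by fun_prop)

theorem hexFun_near_pole (i : ℤ × ℤ) : ∃ r : ℂ → ℂ, AnalyticAt ℂ r (hexPole i) ∧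
    r (hexPole i) = 0 ∧ ∀ z, hexFun z = hexChar i / (z - hexPole i) + r z := by
  obtain ⟨r, hr, h⟩ := hexSum_near_pole i
  have hr' : AnalyticAt ℂ (fun z => r z + (hexSlope * z + hexConst)) (hexPole i) :=
    hr.add (by fun_prop)
  have h' : ∀ z, hexFun z = hexChar i / (z - hexPole i) + (r z + (hexSlope * z + hexConst)) :=
    fun z => by rw [hexFun, h, add_assoc]
  refine ⟨_, hr', ?_, h'⟩
  set s : ℂ → ℂ := fun z => r z + (hexSlope * z + hexConst)
  -- The rotation by ω about the pole preserves the principal part; evaluating the regular part at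
  -- the fixed point gives ω s = s, so the constant Laurent term vanishes.
  have key : ∀ z, hexOmega * s (hexOmega * z + (hexPole i - hexOmega * hexPole i)) = s z := by
    intro z
    have h1 := hexFun_rotation i z
    rw [h', h'] at h1
    have h2 : hexOmega * (hexChar i /
        (hexOmega * z + (hexPole i - hexOmega * hexPole i) - hexPole i)) =
        hexChar i / (z - hexPole i) := by
      rw [show hexOmega * z + (hexPole i - hexOmega * hexPole i) - hexPole i =
        hexOmega * (z - hexPole i) by ring, ← mul_div_assoc,
        mul_div_mul_left _ _ hexOmega_ne_zero]
    linear_combination h1 - h2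
  have h3 := key (hexPole i)
  rw [show hexOmega * hexPole i + (hexPole i - hexOmega * hexPole i) = hexPole i by ring] at h3
  have h4 : (hexOmega - 1) * s (hexPole i) = 0 := by linear_combination h3
  exact (mul_eq_zero.1 h4).resolve_left (sub_ne_zero.2 hexOmega_ne_one)

/-! ### The differential equation -/

theorem ContinuousAt.eq_of_eventuallyEq_nhdsNE {f g : ℂ → ℂ} {z : ℂ} (hf : ContinuousAt f z)
    (hg : ContinuousAt g z) (h : f =ᶠ[𝓝[≠] z] g) : f z = g z :=
  tendsto_nhds_unique ((hf.tendsto.mono_left nhdsWithin_le_nhds).congr' h)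
    (hg.tendsto.mono_left nhdsWithin_le_nhds)

theorem exists_differentiable_of_locally_eventuallyEq {H : ℂ → ℂ}
    (h : ∀ z₀, ∃ k : ℂ → ℂ, AnalyticAt ℂ k z₀ ∧ H =ᶠ[𝓝[≠] z₀] k) :
    ∃ E : ℂ → ℂ, Differentiable ℂ E ∧ ∀ z₀, H =ᶠ[𝓝[≠] z₀] E := by
  choose k hk hH using h
  -- The local extensions agree on overlaps by continuity, so their diagonal is entire.
  have hE : ∀ z, (fun w => k w w) =ᶠ[𝓝 z] k z := by
    intro z
    have h1 := (eventually_eventually_nhdsWithin (a := z) (s := {z}ᶜ)).2 (hH z)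
    rw [eventually_nhdsWithin_iff] at h1
    filter_upwards [h1, (hk z).eventually_analyticAt] with w hw hw2
    rcases eq_or_ne w z with rfl | hne
    · rfl
    · refine (hk w).continuousAt.eq_of_eventuallyEq_nhdsNE hw2.continuousAt ?_
      have h3 : ∀ᶠ y in 𝓝[≠] w, H y = k z y := by
        have := hw hne
        rw [IsOpen.nhdsWithin_eq isOpen_compl_singleton hne] at this
        exact this.filter_mono nhdsWithin_le_nhds
      filter_upwards [h3, hH w] with y hy1 hy2
      rw [← hy1, ← hy2]
  refine ⟨fun w => k w w, fun z => ((hk z).congr (hE z).symm).differentiableAt, fun z => ?_⟩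
  filter_upwards [hH z, (hE z).filter_mono nhdsWithin_le_nhds] with w h1 h2
  rw [h1, h2]

/-- The multipliers have modulus 1, so ‖E‖ is doubly periodic and bounded; E is constant by
Liouville, and ω ≠ 1 makes it zero. -/
theorem eq_zero_of_differentiable_of_quasiperiodic {E : ℂ → ℂ} (hE : Differentiable ℂ E)
    (h1 : ∀ z, E (z + hexZeta) = hexOmega ^ 2 * E z)
    (h2 : ∀ z, E (z + hexZeta⁻¹) = hexOmega * E z) (z : ℂ) : E z = 0 := by
  have p1 : Function.Periodic (fun z => ‖E z‖) hexZeta := fun z => by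
    simp [h1, norm_hexOmega]
  have p2 : Function.Periodic (fun z => ‖E z‖) hexZeta⁻¹ := fun z => by
    simp [h2, norm_hexOmega]
  obtain ⟨C, hC⟩ := (isCompact_closedBall (0 : ℂ) 2).exists_bound_of_continuousOn
    hE.continuous.continuousOn
  have hbound : ∀ z, ‖E z‖ ≤ C := by
    intro z
    set x := z.re / √3 + z.im with hx
    set y := z.re / √3 - z.im with hy
    have hz : z = x * hexZeta + y * hexZeta⁻¹ := by
      have h3 : (√3 : ℝ) ≠ 0 := by positivity
      apply Complex.ext
      · simp only [add_re, mul_re, ofReal_re, ofReal_im, hexZeta_re, hexZeta_inv_re, hexZeta_im,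
          hexZeta_inv_im]
        rw [hx, hy]; field_simp; ring
      · simp only [add_im, mul_im, ofReal_re, ofReal_im, hexZeta_re, hexZeta_inv_re, hexZeta_im,
          hexZeta_inv_im]
        rw [hx, hy]; field_simp; ring
    have h3 : ‖E z‖ = ‖E ((Int.fract x : ℝ) * hexZeta + (Int.fract y : ℝ) * hexZeta⁻¹)‖ := by
      have := (p1.sub_zsmul_eq (x := z - ⌊y⌋ • hexZeta⁻¹) ⌊x⌋).trans (p2.sub_zsmul_eq ⌊y⌋)
      rw [← this]
      congr 2
      rw [Int.fract, Int.fract]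
      simp only [zsmul_eq_mul]
      push_cast
      linear_combination hz
    rw [h3]
    apply hC
    rw [mem_closedBall_zero_iff]
    refine (norm_add_le _ _).trans ?_
    rw [norm_mul, norm_mul, norm_inv, norm_hexZeta, norm_real, norm_real, Real.norm_eq_abs,
      Real.norm_eq_abs, abs_of_nonneg (Int.fract_nonneg _), abs_of_nonneg (Int.fract_nonneg _)]
    linarith [(Int.fract_lt_one x).le, (Int.fract_lt_one y).le]
  have hconst := hE.apply_eq_apply_of_bounded
    (isBounded_iff_forall_norm_le.2 ⟨C, by rintro _ ⟨z, rfl⟩; exact hbound z⟩)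
  have h3 := h2 z
  rw [hconst (z + hexZeta⁻¹) z] at h3
  have h4 : (hexOmega - 1) * E z = 0 := by linear_combination -h3
  exact (mul_eq_zero.1 h4).resolve_left (sub_ne_zero.2 hexOmega_ne_one)

theorem hexPole_one_sub (i : ℤ × ℤ) : hexPole (1 - i) = -hexPole i := by
  simp only [hexPole, Prod.fst_sub, Prod.snd_sub, Prod.fst_one, Prod.snd_one]; push_cast; ring

theorem hexChar_one_sub_sq (i : ℤ × ℤ) : hexChar (1 - i) ^ 2 = hexChar i := by
  rw [hexChar_eq, hexChar_eq, ← zpow_natCast, ← zpow_mul]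
  refine hexOmega_zpow_mod (k := 2 - (2 * i.1 + i.2)) ?_
  simp only [Prod.fst_sub, Prod.snd_sub, Prod.fst_one, Prod.snd_one]; push_cast; ring

theorem neg_notMem_range_hexPole {z : ℂ} (hz : z ∉ Set.range hexPole) :
    -z ∉ Set.range hexPole := by
  rintro ⟨i, hi⟩
  exact hz ⟨1 - i, by rw [hexPole_one_sub, hi, neg_neg]⟩

/-- At a pole p the double poles cancel by `hexChar_one_sub_sq`. The square has no simple pole
because F has zero constant term at -p; `dslope` carries out that division. -/
theorem deriv_hexFun_add_sq_removable (z₀ : ℂ) : ∃ k : ℂ → ℂ, AnalyticAt ℂ k z₀ ∧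
    (fun z => deriv hexFun z + hexFun (-z) ^ 2) =ᶠ[𝓝[≠] z₀] k := by
  by_cases hz : z₀ ∈ Set.range hexPole
  · obtain ⟨i, rfl⟩ := hz
    obtain ⟨r, hr, -, h⟩ := hexFun_near_pole i
    obtain ⟨s, hs, hs0, h'⟩ := hexFun_near_pole (1 - i)
    rw [hexPole_one_sub] at hs hs0 h'
    set p := hexPole i
    have hs2 : AnalyticAt ℂ (fun z => s (-z)) p := hs.fun_comp analyticAt_id.fun_neg
    have hs3 : AnalyticAt ℂ (dslope (fun z => s (-z)) p) p := by
      obtain ⟨q, hq⟩ := hs2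
      exact hq.has_fpower_series_dslope_fslope.analyticAt
    refine ⟨fun z => deriv r z - 2 * hexChar (1 - i) * dslope (fun z => s (-z)) p z + s (-z) ^ 2,
      (hr.deriv.sub (analyticAt_const.mul hs3)).add (hs2.pow 2), ?_⟩
    filter_upwards [self_mem_nhdsWithin, hr.eventually_analyticAt.filter_mono nhdsWithin_le_nhds]
      with z hz hrz
    have hz' : z - p ≠ 0 := sub_ne_zero.2 hz
    have hd : deriv hexFun z = -hexChar i / (z - p) ^ 2 + deriv r z := by
      rw [funext h]
      have h1 : HasDerivAt (fun z => hexChar i / (z - p)) (-hexChar i / (z - p) ^ 2) z := by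
        have := ((hasDerivAt_const z (hexChar i)).fun_div ((hasDerivAt_id z).sub_const p) hz')
        simpa using this
      exact (h1.add hrz.differentiableAt.hasDerivAt).deriv
    have hsl : s (-z) = (z - p) * dslope (fun z => s (-z)) p z := by
      have := sub_smul_dslope (fun z => s (-z)) p z
      rw [smul_eq_mul] at this
      rw [this, hs0, sub_zero]
    have hd2 : deriv r z - 2 * hexChar (1 - i) * dslope (fun z => s (-z)) p z + s (-z) ^ 2 =
        deriv r z - 2 * hexChar (1 - i) * s (-z) / (z - p) + s (-z) ^ 2 := by
      congr 2
      rw [hsl]; field_simp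
    rw [hd, hd2, h', ← hexChar_one_sub_sq i, show -z - -p = -(z - p) by ring]
    field_simp
    ring
  · refine ⟨_, ?_, EventuallyEq.rfl⟩
    exact (analyticAt_hexFun hz).deriv.add
      (((analyticAt_hexFun (neg_notMem_range_hexPole hz)).fun_comp analyticAt_id.fun_neg).pow 2)

theorem deriv_hexFun {z : ℂ} (hz : z ∉ Set.range hexPole) :
    deriv hexFun z = -hexFun (-z) ^ 2 := by
  set H : ℂ → ℂ := fun z => deriv hexFun z + hexFun (-z) ^ 2 with hH
  have hω := hexOmega_pow_three
  have hd1 (z : ℂ) : deriv hexFun (z + hexZeta) = hexOmega ^ 2 * deriv hexFun z := by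
    rw [← deriv_comp_add_const, funext hexFun_add_zeta, deriv_const_mul_field]
  have hd2 (z : ℂ) : deriv hexFun (z + hexZeta⁻¹) = hexOmega * deriv hexFun z := by
    rw [← deriv_comp_add_const, funext hexFun_add_zeta_inv, deriv_const_mul_field]
  have hn1 (z : ℂ) : hexFun (-(z + hexZeta)) = hexOmega * hexFun (-z) := by
    have := hexFun_add_zeta (-(z + hexZeta))
    rw [show -(z + hexZeta) + hexZeta = -z by ring] at this
    rw [this]; linear_combination -hexFun (-(z + hexZeta)) * hω
  have hn2 (z : ℂ) : hexFun (-(z + hexZeta⁻¹)) = hexOmega ^ 2 * hexFun (-z) := by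
    rw [← hexFun_sub_zeta_inv]; congr 1; ring
  have hH1 (z : ℂ) : H (z + hexZeta) = hexOmega ^ 2 * H z := by
    simp only [hH, hd1, hn1]; ring
  have hH2 (z : ℂ) : H (z + hexZeta⁻¹) = hexOmega * H z := by
    simp only [hH, hd2, hn2]; linear_combination hexOmega * hexFun (-z) ^ 2 * hω
  obtain ⟨E, hE, hEH⟩ := exists_differentiable_of_locally_eventuallyEq
    deriv_hexFun_add_sq_removable
  have hshift (l u : ℂ) (h : ∀ z, H (z + l) = u * H z) (z : ℂ) : E (z + l) = u * E z := by
    refine ContinuousAt.eq_of_eventuallyEq_nhdsNE (f := fun z => E (z + l))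
      (g := fun z => u * E z) (z := z) (by have := hE.continuous; fun_prop)
      (by have := hE.continuous; fun_prop) ?_
    have ht : Tendsto (fun w => w + l) (𝓝[≠] z) (𝓝[≠] (z + l)) := by
      refine tendsto_nhdsWithin_of_tendsto_nhds_of_eventually_within _
        ((by fun_prop : Continuous fun w : ℂ => w + l).continuousAt.tendsto.mono_left
          nhdsWithin_le_nhds) ?_
      filter_upwards [self_mem_nhdsWithin] with w hw
      simpa using hw
    filter_upwards [hEH z, ht.eventually (hEH (z + l))] with w h1 h2
    rw [← h2, ← h1]
    exact h w
  have hE0 := eq_zero_of_differentiable_of_quasiperiodic hE (hshift _ _ hH1) (hshift _ _ hH2)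
  have hHz : H z = 0 := by
    rw [← hE0 z]
    refine ContinuousAt.eq_of_eventuallyEq_nhdsNE ?_ hE.continuous.continuousAt (hEH z)
    exact ((analyticAt_hexFun hz).deriv.add (((analyticAt_hexFun
      (neg_notMem_range_hexPole hz)).fun_comp analyticAt_id.fun_neg).pow 2)).continuousAt
  linear_combination hHz

/-! ### Taylor coefficients at the origin -/

theorem analyticAt_hexFun_zero : AnalyticAt ℂ hexFun 0 :=
  analyticAt_hexFun (hexPole_notMem_of_norm_lt (by simp))

theorem iteratedDeriv_hexFun_zero (n : ℕ) :
    iteratedDeriv n hexFun 0 = hexFun 0 ^ (n + 1) * pseudoFactorial n := by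
  induction n using Nat.strong_induction_on with
  | _ n ih =>
    rcases n with - | n
    · simp [pseudoFactorial_zero]
    · have h1 : deriv hexFun =ᶠ[𝓝 0] fun z => (fun w => -(hexFun w * hexFun w)) (-z) := by
        filter_upwards [Metric.ball_mem_nhds (0 : ℂ) (by norm_num : (0 : ℝ) < 1 / 2)] with z hz
        rw [deriv_hexFun (hexPole_notMem_of_norm_lt (by simpa using hz)), pow_two]
      rw [iteratedDeriv_succ', h1.iteratedDeriv_eq, 
        iteratedDeriv_comp_neg n (fun w => -(hexFun w * hexFun w)), neg_zero,
        iteratedDeriv_fun_neg, iteratedDeriv_fun_mul analyticAt_hexFun_zero.contDiffAt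
          analyticAt_hexFun_zero.contDiffAt, pseudoFactorial_succ]
      push_cast
      rw [smul_eq_mul, ← Finset.sum_neg_distrib, Finset.mul_sum, Finset.mul_sum, Finset.mul_sum]
      refine Finset.sum_congr rfl fun k hk => ?_
      have hk' : k ≤ n := by simpa [Nat.lt_succ_iff] using hk
      obtain ⟨m, rfl⟩ := Nat.exists_eq_add_of_le hk'
      rw [ih k (by omega), ih (k + m - k) (by omega), Nat.add_sub_cancel_left]
      ring

/-- Every pole has norm at least 1/2, so ‖z/p‖ ≤ 1/2: expand each fraction geometrically and
exchange the absolutely convergent sums. -/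
theorem hasSum_hexSum {z : ℂ} (hz : ‖z‖ ≤ 1 / 4) :
    HasSum (fun k : ℕ => z ^ (k + 2) * -∑' i, hexChar i / hexPole i ^ (k + 3)) (hexSum z) := by
  set f : (ℤ × ℤ) → ℕ → ℂ := fun i k => z ^ (k + 2) * -(hexChar i / hexPole i ^ (k + 3)) with hf
  have hratio (i : ℤ × ℤ) : ‖z / hexPole i‖ ≤ 1 / 2 := by
    have := half_le_norm_hexPole i
    rw [norm_div, div_le_iff₀ (by linarith)]
    linarith
  have hfeq (i : ℤ × ℤ) (k : ℕ) :
      f i k = -(z ^ 2 * hexChar i / hexPole i ^ 3) * (z / hexPole i) ^ k := by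
    have := hexPole_ne_zero i
    simp only [hf, div_pow]; field_simp; ring
  have hs : Summable (Function.uncurry f) := by
    have hu : Summable fun i => ‖z‖ ^ 2 * (1 / ‖hexPole i‖ ^ 3) :=
      summable_norm_hexPole_cube.mul_left _
    have hv : Summable fun k : ℕ => (1 / 2 : ℝ) ^ k :=
      summable_geometric_of_lt_one (by norm_num) (by norm_num)
    have huv := Summable.mul_of_nonneg hu hv (fun i => by positivity) (fun k => by positivity)
    refine Summable.of_norm_bounded huv ?_
    rintro ⟨i, k⟩
    rw [Function.uncurry_apply_pair, hfeq, norm_mul, norm_neg, norm_div, norm_mul, norm_hexChar,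
      mul_one, norm_pow, norm_pow, norm_pow, mul_one_div]
    exact mul_le_mul_of_nonneg_left (pow_le_pow_left₀ (norm_nonneg _) (hratio i) k)
      (by positivity)
  have h1 : ∀ i, ∑' k, f i k = hexFraction i z := by
    intro i
    have hp := hexPole_ne_zero i
    have hlt : ‖z / hexPole i‖ < 1 := (hratio i).trans_lt (by norm_num)
    have hne : z ≠ hexPole i := by
      rintro rfl
      rw [div_self hp] at hlt
      simp at hlt
    have h2 := sub_ne_zero.2 hne
    have h3 := sub_ne_zero.2 hne.symm
    simp_rw [hfeq]
    rw [tsum_mul_left, tsum_geometric_of_norm_lt_one hlt, hexFraction_eq hne]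
    rw [one_sub_div hp]
    field_simp
    ring
  have h2 : Summable fun k => ∑' i, f i k := hs.prod_symm.prod
  have h3 : ∑' k, ∑' i, f i k = hexSum z := by
    rw [hexSum, hs.tsum_comm]
    exact tsum_congr h1
  rw [← h3]
  convert h2.hasSum using 2 with k
  simp only [hf]
  rw [tsum_mul_left, tsum_neg]

theorem iteratedDeriv_hexFun_zero_eq_tsum {n : ℕ} (hn : 2 ≤ n) :
    iteratedDeriv n hexFun 0 = -(n.factorial * ∑' i, hexChar i / hexPole i ^ (n + 1)) := by
  -- The affine correction only affects orders 0 and 1, whence n ≥ 2.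
  set c : ℕ → ℂ := fun k => if k = 0 then hexConst else if k = 1 then hexSlope else
    -∑' i, hexChar i / hexPole i ^ (k + 1) with hc
  have hps : HasFPowerSeriesAt hexFun (FormalMultilinearSeries.ofScalars ℂ c) 0 := by
    rw [hasFPowerSeriesAt_iff]
    filter_upwards [Metric.ball_mem_nhds (0 : ℂ) (by norm_num : (0 : ℝ) < 1 / 4)] with z hz
    have h := hasSum_hexSum (z := z) (by simpa using (Metric.mem_ball.1 hz).le)
    rw [← hasSum_nat_add_iff' 2]
    have e1 : hexFun (0 + z) - ∑ i ∈ Finset.range 2,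
        z ^ i • (FormalMultilinearSeries.ofScalars ℂ c).coeff i = hexSum z := by
      simp [FormalMultilinearSeries.coeff_ofScalars, hexFun, Finset.sum_range_succ, hc]
      ring
    have e2 : (fun k => z ^ (k + 2) • (FormalMultilinearSeries.ofScalars ℂ c).coeff (k + 2)) =
        fun k : ℕ => z ^ (k + 2) * -∑' i, hexChar i / hexPole i ^ (k + 3) := by
      funext k
      rw [FormalMultilinearSeries.coeff_ofScalars, smul_eq_mul, hc]
      simp only [if_neg (show ¬ k + 2 = 0 by omega), if_neg (show ¬ k + 2 = 1 by omega)]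
    rw [e1, e2]
    exact h
  have h := congrArg (fun p => p.coeff n)
    (analyticAt_hexFun_zero.hasFPowerSeriesAt.eq_formalMultilinearSeries hps)
  simp only [FormalMultilinearSeries.coeff_ofScalars, hc] at h
  rw [if_neg (by omega), if_neg (by omega),
    div_eq_iff (Nat.cast_ne_zero.2 n.factorial_ne_zero)] at h
  rw [h]; ring

/-! ### The value at the origin -/

theorem hexFun_sqrt_three_div_six : hexFun (√3 / 6 : ℝ) = 0 := by
  have hc : ((√3 / 6 : ℝ) : ℂ) = (hexZeta + hexZeta⁻¹) / 6 := by
    rw [hexZeta_add_inv]; push_cast; ring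
  set c : ℂ := ((√3 / 6 : ℝ) : ℂ)
  have h1 := hexFun_rotation 0 c
  -- Rotation about the pole -√3/2 moves c by a lattice vector, so the two symmetries give F(c) = ω²
  -- F(c).
  have h2 : hexOmega * c + (hexPole 0 - hexOmega * hexPole 0) =
      c - hexZeta⁻¹ - hexZeta⁻¹ := by
    rw [hc]
    simp only [hexPole, Prod.fst_zero, Prod.snd_zero]; push_cast
    linear_combination (2 / 3 : ℂ) * hexOmega_mul_zeta + (2 / 3 : ℂ) * hexOmega_mul_zeta_inv
  rw [h2, hexFun_sub_zeta_inv, hexFun_sub_zeta_inv] at h1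
  have h3 : (hexOmega ^ 2 - 1) * hexFun c = 0 := by
    linear_combination h1 - hexOmega ^ 2 * hexFun c * hexOmega_pow_three
  exact (mul_eq_zero.1 h3).resolve_left (sub_ne_zero.2 hexOmega_sq_ne_one)

/-- Otherwise all derivatives at 0 vanish, so F vanishes on the connected complement of the
countable pole set, contradicting a residue of modulus 1. -/
theorem hexFun_zero_ne_zero : hexFun 0 ≠ 0 := by
  intro h0
  have hev : hexFun =ᶠ[𝓝 0] 0 := by
    have h := analyticAt_hexFun_zero.hasFPowerSeriesAt
    rw [hasFPowerSeriesAt_iff] at h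
    filter_upwards [h] with z hz
    simp only [FormalMultilinearSeries.coeff_ofScalars, iteratedDeriv_hexFun_zero, h0, zero_add,
      smul_eq_mul] at hz
    simpa using hz.tsum_eq.symm
  have hcount : (Set.range hexPole).Countable := Set.countable_range _
  have hEq : Set.EqOn hexFun 0 (Set.range hexPole)ᶜ :=
    AnalyticOnNhd.eqOn_zero_of_preconnected_of_eventuallyEq_zero
      (fun z hz => analyticAt_hexFun hz)
      (hcount.isConnected_compl_of_one_lt_rank (by simp)).isPreconnected
      (hexPole_notMem_of_norm_lt (by simp)) hev
  obtain ⟨r, hr, -, h⟩ := hexFun_near_pole 0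
  have hfreq : ∃ᶠ z in 𝓝 (hexPole 0), z ∈ (Set.range hexPole)ᶜ :=
    mem_closure_iff_frequently.1 (hcount.dense_compl ℝ _)
  have hsmall : ∀ᶠ z in 𝓝 (hexPole 0), ‖(z - hexPole 0) * r z‖ < 1 := by
    have hcont : ContinuousAt (fun z => ‖(z - hexPole 0) * r z‖) (hexPole 0) := by
      have := hr.continuousAt
      fun_prop
    exact hcont.eventually (gt_mem_nhds (by simp))
  obtain ⟨z, hz, hz1⟩ := (hfreq.and_eventually hsmall).exists
  have hne : z - hexPole 0 ≠ 0 := by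
    intro h
    exact hz ⟨0, (sub_eq_zero.1 h).symm⟩
  have h1 : hexChar 0 / (z - hexPole 0) + r z = 0 := by rw [← h]; exact hEq hz
  have h2 : (z - hexPole 0) * r z = -hexChar 0 := by
    field_simp at h1
    linear_combination h1
  rw [h2, norm_neg, norm_hexChar] at hz1
  exact lt_irrefl _ hz1

/-- The restriction of `hexFun` to the real line. -/
noncomputable def hexRealFun (x : ℝ) : ℝ := (hexFun x).re

theorem hexFun_ofReal (x : ℝ) : hexFun x = hexRealFun x :=
  Complex.ext rfl (hexFun_ofReal_im x)

theorem hasDerivAt_hexRealFun {x : ℝ} (hx : |x| < 1 / 2) :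
    HasDerivAt hexRealFun (-hexRealFun (-x) ^ 2) x := by
  have hx' : (x : ℂ) ∉ Set.range hexPole := hexPole_notMem_of_norm_lt (by simpa using hx)
  have h := (analyticAt_hexFun hx').differentiableAt.hasDerivAt
  rw [deriv_hexFun hx', ← ofReal_neg, hexFun_ofReal, ← ofReal_pow, ← ofReal_neg] at h
  exact h.real_of_complex

theorem hasDerivAt_hexRealFun_neg {x : ℝ} (hx : |x| < 1 / 2) :
    HasDerivAt (fun x => hexRealFun (-x)) (hexRealFun x ^ 2) x := by
  have h := (hasDerivAt_hexRealFun (x := -x) (by rwa [abs_neg])).scomp x (hasDerivAt_neg x)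
  simpa [Function.comp_def] using h

theorem hexRealFun_cube_add {x : ℝ} (hx : |x| < 1 / 2) :
    hexRealFun x ^ 3 + hexRealFun (-x) ^ 3 = 2 * hexRealFun 0 ^ 3 := by
  have hd : ∀ x ∈ Set.Ioo (-(1 / 2) : ℝ) (1 / 2),
      HasDerivAt (fun x => hexRealFun x ^ 3 + hexRealFun (-x) ^ 3) 0 x := by
    intro x hx
    have hx' := abs_lt.2 hx
    refine (((hasDerivAt_hexRealFun hx').fun_pow 3).fun_add
      ((hasDerivAt_hexRealFun_neg hx').fun_pow 3)).congr_deriv ?_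
    push_cast; ring
  have := isOpen_Ioo.is_const_of_deriv_eq_zero isPreconnected_Ioo
    (fun x hx => (hd x hx).differentiableAt.differentiableWithinAt)
    (fun x hx => (hd x hx).deriv) (abs_lt.1 hx) (y := 0) (by norm_num)
  simp only [neg_zero] at this
  rw [this]; ring

theorem sqrt_three_div_six_lt : √3 / 6 < 1 / 2 := by
  have : √3 < 3 := by rw [Real.sqrt_lt' (by norm_num)]; norm_num
  linarith

theorem abs_lt_half_of_mem_Icc {x : ℝ} (hx : x ∈ Set.Icc (-(√3 / 6)) (√3 / 6)) :
    |x| < 1 / 2 :=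
  (abs_le.2 hx).trans_lt sqrt_three_div_six_lt

theorem continuousOn_hexRealFun : ContinuousOn hexRealFun (Set.Icc (-(√3 / 6)) (√3 / 6)) :=
  fun _ hx => (hasDerivAt_hexRealFun (abs_lt_half_of_mem_Icc hx)).continuousAt.continuousWithinAt

theorem antitoneOn_hexRealFun : AntitoneOn hexRealFun (Set.Icc (-(√3 / 6)) (√3 / 6)) := by
  refine antitoneOn_of_deriv_nonpos (convex_Icc _ _) continuousOn_hexRealFun ?_ ?_
  · intro x hx
    exact (hasDerivAt_hexRealFun (abs_lt_half_of_mem_Icc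
      (interior_subset hx))).differentiableAt.differentiableWithinAt
  · intro x hx
    rw [(hasDerivAt_hexRealFun (abs_lt_half_of_mem_Icc (interior_subset hx))).deriv]
    linarith [sq_nonneg (hexRealFun (-x))]

theorem hexRealFun_sqrt_three_div_six : hexRealFun (√3 / 6) = 0 := by
  rw [hexRealFun, hexFun_sqrt_three_div_six, zero_re]

theorem hexRealFun_zero_pos : 0 < hexRealFun 0 := by
  have h0 : (0 : ℝ) ≤ √3 / 6 := by positivity
  have h1 : hexRealFun (√3 / 6) ≤ hexRealFun 0 :=
    antitoneOn_hexRealFun ⟨by linarith, h0⟩ ⟨by linarith, le_rfl⟩ h0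
  rw [hexRealFun_sqrt_three_div_six] at h1
  refine lt_of_le_of_ne h1 fun h => hexFun_zero_ne_zero ?_
  have := hexFun_ofReal 0
  rw [← h] at this
  simpa using this

/-- For x ≤ 0 monotonicity gives F(x) ≥ F(0) > 0. This makes F'(y) = -F(-y)² negative for y ≥ 0, so
F decreases strictly to its zero at √3/6. -/
theorem hexRealFun_pos {x : ℝ} (hx : x ∈ Set.Ioo (-(√3 / 6)) (√3 / 6)) : 0 < hexRealFun x := by
  have h0 : (0 : ℝ) < √3 / 6 := by positivity
  have hneg : ∀ x ∈ Set.Icc (-(√3 / 6)) 0, 0 < hexRealFun x := fun x hx =>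
    hexRealFun_zero_pos.trans_le
      (antitoneOn_hexRealFun ⟨hx.1, hx.2.trans h0.le⟩ ⟨by linarith, h0.le⟩ hx.2)
  rcases le_total x 0 with hx0 | hx0
  · exact hneg x ⟨hx.1.le, hx0⟩
  · have hsub : Set.Icc 0 (√3 / 6) ⊆ Set.Icc (-(√3 / 6)) (√3 / 6) :=
      Set.Icc_subset_Icc_left (by linarith)
    have hstrict : StrictAntiOn hexRealFun (Set.Icc 0 (√3 / 6)) := by
      refine strictAntiOn_of_deriv_neg (convex_Icc _ _) (continuousOn_hexRealFun.mono hsub) ?_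
      intro y hy
      have hy' := interior_subset hy
      rw [(hasDerivAt_hexRealFun (abs_lt_half_of_mem_Icc (hsub hy'))).deriv]
      have := hneg (-y) ⟨by linarith [hy'.2], by linarith [hy'.1]⟩
      have := pow_pos this 2
      linarith
    have := hstrict ⟨hx0, hx.2.le⟩ ⟨h0.le, le_rfl⟩ hx.2
    rwa [hexRealFun_sqrt_three_div_six] at this

theorem piThree_eq : piThree = (2 : ℝ) ^ (1 / 3 : ℝ) * hexRealFun 0 * √3 := by
  set b : ℝ := (2 : ℝ) ^ (1 / 3 : ℝ) with hb
  have hb3 : b ^ 3 = 2 := by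
    rw [hb, ← Real.rpow_natCast, ← Real.rpow_mul (by norm_num)]; norm_num
  have hbpos : 0 < b := by positivity
  have hg := hexRealFun_zero_pos
  set m : ℝ := b * hexRealFun 0 with hm
  have hmpos : 0 < m := by positivity
  have hm3 : m ^ 3 = 2 * hexRealFun 0 ^ 3 := by rw [hm, mul_pow, hb3]
  set c : ℝ := √3 / 6 with hc
  have hcpos : 0 < c := by positivity
  set f : ℝ → ℝ := fun x => hexRealFun (-x) / m with hf
  have hd : ∀ x ∈ Set.Icc (-c) c, HasDerivAt f (hexRealFun x ^ 2 / m) x := fun x hx =>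
    (hasDerivAt_hexRealFun_neg (abs_lt_half_of_mem_Icc hx)).div_const m
  have hcont : ContinuousOn f (Set.Icc (-c) c) := fun x hx =>
    (hd x hx).continuousAt.continuousWithinAt
  have hmono : StrictMonoOn f (Set.Icc (-c) c) := by
    refine strictMonoOn_of_deriv_pos (convex_Icc _ _) hcont fun x hx => ?_
    rw [(hd x (interior_subset hx)).deriv]
    rw [interior_Icc] at hx
    have := hexRealFun_pos hx
    positivity
  have hfl : f (-c) = 0 := by
    simp only [hf, neg_neg, hc, hexRealFun_sqrt_three_div_six, zero_div]
  have hfr : f c = 1 := by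
    have h1 := hexRealFun_cube_add (abs_lt_half_of_mem_Icc (x := c) ⟨by linarith, le_rfl⟩)
    rw [hexRealFun_sqrt_three_div_six, ← hm3, zero_pow (by norm_num), zero_add] at h1
    have h2 : hexRealFun (-c) = m := (Odd.strictMono_pow (by decide : Odd 3)).injective h1
    simp only [hf, h2, div_self hmpos.ne']
  have himage : f '' Set.Ioo (-c) c = Set.Ioo 0 1 := by
    apply Set.Subset.antisymm
    · rintro _ ⟨x, hx, rfl⟩
      rw [← hfl, ← hfr]
      exact ⟨hmono ⟨le_rfl, by linarith⟩ ⟨hx.1.le, hx.2.le⟩ hx.1,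
        hmono ⟨hx.1.le, hx.2.le⟩ ⟨by linarith, le_rfl⟩ hx.2⟩
    · rw [← hfl, ← hfr]
      exact intermediate_value_Ioo (by linarith) hcont
  have hint : ∫ y in (0 : ℝ)..1, 1 / (1 - y ^ 3) ^ (2 / 3 : ℝ) = m * (2 * c) := by
    rw [intervalIntegral.integral_of_le zero_le_one,
      MeasureTheory.integral_Ioc_eq_integral_Ioo, ← himage,
      MeasureTheory.integral_image_eq_integral_abs_deriv_smul measurableSet_Ioo
        (fun x hx => (hd x ⟨hx.1.le, hx.2.le⟩).hasDerivWithinAt)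
        (hmono.injOn.mono Set.Ioo_subset_Icc_self),
      MeasureTheory.setIntegral_congr_fun (g := fun _ => m) measurableSet_Ioo]
    · rw [MeasureTheory.setIntegral_const, Real.volume_real_Ioo_of_le (by linarith), smul_eq_mul]
      ring
    · intro x hx
      have hpos := hexRealFun_pos hx
      have h1 := hexRealFun_cube_add (abs_lt_half_of_mem_Icc ⟨hx.1.le, hx.2.le⟩)
      -- The first integral with m³ = 2F(0)³; as f' = F²/m, the transformed integrand is the
      -- constant m.
      have h2 : 1 - f x ^ 3 = (hexRealFun x / m) ^ 3 := by
        simp only [hf, div_pow]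
        field_simp
        rw [hm3]; linarith
      have h3 : ((hexRealFun x / m) ^ 3) ^ (2 / 3 : ℝ) = (hexRealFun x / m) ^ 2 := by
        rw [← Real.rpow_natCast, ← Real.rpow_mul (by positivity), ← Real.rpow_natCast]
        norm_num
      have h4 : 0 < hexRealFun x ^ 2 / m := by positivity
      simp only [h2, h3, smul_eq_mul, abs_of_pos h4]
      field_simp
  rw [piThree, hint, hc]; ring

theorem hexRho_eq : hexRho = hexRealFun 0 := by
  have h2 : (2 : ℝ) ^ (1 / 3 : ℝ) * (2 : ℝ) ^ (-(1 / 3) : ℝ) = 1 := by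
    rw [← Real.rpow_add (by norm_num)]; norm_num
  have h3 : √3 * √3 = 3 := Real.mul_self_sqrt (by norm_num)
  rw [hexRho, hexR, piThree_eq]
  linear_combination (√3 * √3 * hexRealFun 0 / 3) * h2 + hexRealFun 0 / 3 * h3

theorem hexFun_zero_eq : hexFun 0 = hexRho := by
  rw [hexRho_eq, ← hexFun_ofReal, ofReal_zero]

theorem theorem3 (n : ℕ) (hn : 2 ≤ n) :
    Summable (fun p : ℤ × ℤ => hexTerm n p.1 p.2) ∧
      (pseudoFactorial n : ℂ) =
        -((n.factorial : ℂ) / (hexRho : ℂ) ^ (n + 1)) *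
          ∑' p : ℤ × ℤ, hexTerm n p.1 p.2 := by
  refine ⟨summable_hexTerm hn, ?_⟩
  have h := iteratedDeriv_hexFun_zero n
  rw [iteratedDeriv_hexFun_zero_eq_tsum hn, hexFun_zero_eq] at h
  have hρ : (hexRho : ℂ) ≠ 0 := hexFun_zero_eq ▸ hexFun_zero_ne_zero
  simp only [hexTerm_eq]
  field_simp
  linear_combination -h
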